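/- Let $k\ge 2$ be an even integer and let $m\ge 0$ be an integer. A $k$-uniform hypertree is a finite hypergraph $T$ with vertex set $V(T)\neq\emptyset$ and a set $E(T)$ of edges, each a $k$-element subset of $V(T)$, that is connected (any two vertices are joined by a walk) and acyclic (there is no cycle $v_0e_0v_1e_1\cdots v_{l-1}e_{l-1}v_0$ with $l\ge 2$, distinct vertices $v_i$, distinct edges $e_i$, and $v_i,v_{i+1}\in e_i$ with indices modulo $l$). The adjacency tensor $\mathcal A(T)=(a_{i_1\cdots i_k})$ is indexed by vertices, with $a_{i_1\cdots i_k}=\frac1{(k-1)!}$ if $\{i_1,\dots,i_k\}\in E(T)$ and $a_{i_1\cdots i_k}=0$ otherwise. An H-eigenvalue of $\mathcal A(T)$ is a real number $\lambda$ for which there is a nonzero real vector $x$ with $$\sum_{i_2,\dots,i_k\in V(T)}a_{i i_2\cdots i_k}x_{i_2}\cdots x_{i_k}=\lambda x_i^{k-1}\qquad\text{for all } i\in V(T).$$ The hyperstar $S_m^k$ is the $k$-th power of the star with $m$ edges, that is, the hypergraph obtained from the star by adding to each edge $k-2$ additional vertices of its own. Then $S_m^k$ is a $k$-uniform hypertree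 with $m$ edges, the adjacency tensor of every $k$-uniform hypertree $T$ with $m$ edges has a least H-eigenvalue $\lambda_{\min}(T)$, and, up to isomorphism, $S_m^k$ is the unique minimizer of $\lambda_{\min}$ among all $k$-uniform hypertrees with $m$ edges: such a hypertree $T$ satisfies $\lambda_{\min}(T)\le\lambda_{\min}(T')$ for all $k$-uniform hypertrees $T'$ with $m$ edges if and only if $T$ is isomorphic to $S_m^k$. -/

import Mathlib

/-- A real tensor of order `k` with indices in `ι` (dimension `|ι|`). -/
abbrev RealTensor (k : ℕ) (ι : Type*) : Type _ := (Fin k → ι) → ℝ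

namespace RealTensor

open Classical in
/-- The vector `A x^(k-1)`: its `i`-th entry is the sum, over all multi-indices
`(i, i₂, …, i_k)` with first index `i`, of `A (i, i₂, …, i_k) * x i₂ * ⋯ * x i_k`. -/
noncomputable def apply {k : ℕ} [NeZero k] {ι : Type*} [Fintype ι]
    (A : RealTensor k ι) (x : ι → ℝ) (i : ι) : ℝ :=
  ∑ f : Fin k → ι with f 0 = i, A f * ∏ j ∈ Finset.univ.erase (0 : Fin k), x (f j)

/-- `μ` is an H-eigenvalue of `A`: there is a nonzero real vector `x` with
`A x^(k-1) = μ x^[k-1]`. -/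
def IsHEigenvalue {k : ℕ} [NeZero k] {ι : Type*} [Fintype ι]
    (A : RealTensor k ι) (μ : ℝ) : Prop :=
  ∃ x : ι → ℝ, x ≠ 0 ∧ ∀ i, A.apply x i = μ * x i ^ (k - 1)

/-- The least H-eigenvalue of `A` (meaningful when the set of H-eigenvalues has a least
element). -/
noncomputable def leastHEigenvalue {k : ℕ} [NeZero k] {ι : Type*} [Fintype ι]
    (A : RealTensor k ι) : ℝ :=
  sInf {μ : ℝ | A.IsHEigenvalue μ}

end RealTensor

namespace Hypergraph

/-- Every edge has exactly `k` vertices (used for `k ≥ 1`). -/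
def IsUniformOfSize {α : Type*} (G : Hypergraph α) (k : ℕ) : Prop :=
  ∀ e ∈ G.edgeSet, e.ncard = k

open Classical in
/-- The adjacency tensor of a `k`-uniform hypergraph, indexed by its vertices: the entry at
`(i₁, …, i_k)` is `1 / (k-1)!` if `{i₁, …, i_k}` is an edge, and `0` otherwise. -/
noncomputable def adjacencyTensor {α : Type*} (G : Hypergraph α) (k : ℕ) :
    RealTensor k G.vertexSet :=
  fun f => if Set.range (fun j => (f j : α)) ∈ G.edgeSet then 1 / ((k - 1).factorial : ℝ) else 0

/-- There is at least one vertex, and any two vertices are joined by a walk, i.e. a chain of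
vertices in which consecutive ones lie in a common edge. -/
def IsConnected {α : Type*} (G : Hypergraph α) : Prop :=
  G.vertexSet.Nonempty ∧
    ∀ u ∈ G.vertexSet, ∀ v ∈ G.vertexSet, Relation.ReflTransGen G.Adj u v

/-- There is a (Berge) cycle `v₀ e₀ v₁ e₁ … v_{n+1} e_{n+1} v₀` of length `n + 2 ≥ 2`, with distinct
vertices and distinct edges, where `vᵢ, vᵢ₊₁ ∈ eᵢ` (indices are cyclic: addition in
`Fin (n + 2)` wraps around). -/
def HasCycle {α : Type*} (G : Hypergraph α) : Prop :=
  ∃ (n : ℕ) (v : Fin (n + 2) → α) (e : Fin (n + 2) → Set α),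
    Function.Injective v ∧ Function.Injective e ∧
      ∀ i, e i ∈ G.edgeSet ∧ v i ∈ e i ∧ v (i + 1) ∈ e i

/-- A hypertree is a connected acyclic hypergraph. -/
def IsHypertree {α : Type*} (G : Hypergraph α) : Prop :=
  G.IsConnected ∧ ¬ G.HasCycle

/-- Isomorphism of hypergraphs: a bijection of the vertex sets that carries edges to edges and
non-edges to non-edges. -/
def Isomorphic {α β : Type*} (G : Hypergraph α) (H : Hypergraph β) : Prop :=
  ∃ f : G.vertexSet ≃ H.vertexSet, ∀ e : Set G.vertexSet,
    Subtype.val '' e ∈ G.edgeSet ↔ Subtype.val '' (f '' e) ∈ H.edgeSet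

/-- The `k`-th power of a simple graph (`k ≥ 2`): each edge `e` is enlarged to a `k`-set by `k - 2`
additional vertices `(e, i)` of its own. -/
def power {V : Type*} (H : SimpleGraph V) (k : ℕ) : Hypergraph (V ⊕ (H.edgeSet × Fin (k - 2))) where
  vertexSet := Set.univ
  edgeSet := Set.range fun e : H.edgeSet =>
    Sum.inl '' {v | v ∈ (e : Sym2 V)} ∪ Sum.inr '' {p | p.1 = e}
  subset_vertexSet_of_mem_edgeSet' := fun _ _ => Set.subset_univ _

/-- The hyperstar `S_m^k`: the `k`-th power of the star with center `0` and `m` edges. -/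
abbrev hyperstar (m k : ℕ) := power (SimpleGraph.starGraph (0 : Fin (m + 1))) k

/-- The least H-eigenvalue of the adjacency tensor of a `k`-uniform hypergraph on finitely many
vertices. -/
noncomputable def leastEigenvalue {α : Type*} (G : Hypergraph α) [Fintype G.vertexSet]
    (k : ℕ) [NeZero k] : ℝ :=
  (G.adjacencyTensor k).leastHEigenvalue

/-- The class of `k`-uniform hypertrees with `m` edges. -/
def IsUniformHypertree {α : Type*} (G : Hypergraph α) (k m : ℕ) : Prop :=
  G.IsUniformOfSize k ∧ G.IsHypertree ∧ G.edgeSet.ncard = m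

/-- `G` is a `k`-uniform hypertree with `m` edges whose least eigenvalue is minimum among all
finite `k`-uniform hypertrees with `m` edges. -/
def IsMinimizingHypertree.{u, v} {α : Type u} (G : Hypergraph α) [Fintype G.vertexSet]
    (k m : ℕ) [NeZero k] : Prop :=
  G.IsUniformHypertree k m ∧
    ∀ (β : Type v) (T : Hypergraph β) [Fintype T.vertexSet], T.IsUniformHypertree k m →
      G.leastEigenvalue k ≤ T.leastEigenvalue k

end Hypergraph

universe u v

/-!
For even `k` the least H-eigenvalue of the adjacency tensor of a `k`-uniform hypergraph is the
minimum of the Rayleigh quotient `k ∑ₑ ∏_{v ∈ e} x v / ∑ᵥ x v ^ k`: the minimum is attained by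
compactness, a minimizer is a critical point and hence an eigenvector, and every H-eigenvalue is
the Rayleigh quotient of its eigenvector (`RealTensor.exists_isLeast_isHEigenvalue`).

Put `r = m ^ (1 / k)`. The least H-eigenvalue of a hypertree with `m` edges is at least `-r`. For
`v ∈ e` let `n(v, e)` be the number of edges on the side of `e` when the incidence of `v` and `e`
is removed from the incidence tree (`branchSize`), and weight the incidence by
`B(v, e) = n(v, e) / m`. The branches at a vertex are disjoint, so `∑_{e ∋ v} B(v, e) ≤ 1`. The
`m - 1` edges other than `e` are distributed over the vertices of `e`, so
`∑_{v ∈ e} (1 - B(v, e)) ≤ (m - 1) / m`, and Weierstrass' product inequality gives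
`∏_{v ∈ e} B(v, e) ≥ 1 / m`. With these weights the inequality of arithmetic and geometric means
reads `k ∏_{v ∈ e} |x v| ≤ r ∑_{v ∈ e} B(v, e) |x v| ^ k`, and summation over the edges gives
the bound (`neg_le_of_rayleigh_eq`).

If `-r` is attained, every one of these inequalities is an equality. Then by connectedness no
coordinate of the eigenvector vanishes, and the strict form of Weierstrass' inequality shows that no
edge has two vertices of degree at least two (`eq_of_mem_of_rayleigh_eq_neg`); a connected family
with this property is a star (`exists_isStarAt`). Conversely, on a star the vector equal to `-r` at
the centre and `1` elsewhere is an eigenvector for `-r` (if `m > 0`), and any two uniform stars with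
the same parameters are isomorphic (`Hypergraph.IsUniformStar.isomorphic`).
-/

open Finset

/-! ### Contractions of adjacency tensors -/

/-- The enumerations of an `(n + 1)`-element set that start with a prescribed element. -/
lemma card_filter_zero_image_eq {V : Type*} [Fintype V] [DecidableEq V] {n : ℕ} {i : V}
    {s : Finset V} (hi : i ∈ s) (hs : s.card = n + 1) :
    #{f : Fin (n + 1) → V | f 0 = i ∧ univ.image f = s} = n.factorial := by
  have hcard : Fintype.card (Fin n) = Fintype.card (s.erase i) := by
    rw [Fintype.card_fin, Fintype.card_coe, Finset.card_erase_of_mem hi, hs, Nat.add_sub_cancel]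
  have key : Fintype.card (Fin n ≃ s.erase i) = n.factorial := by
    rw [Fintype.card_equiv (Fintype.equivOfCardEq hcard), Fintype.card_fin]
  rw [← key, ← Finset.card_univ]
  symm
  refine Finset.card_bij (fun e _ => Fin.cons i fun j => (e j : V)) ?_ ?_ ?_
  · intro e _
    simp only [mem_filter, mem_univ, true_and, Fin.cons_zero]
    ext v
    simp only [mem_image, mem_univ, true_and, Fin.exists_fin_succ, Fin.cons_zero, Fin.cons_succ]
    constructor
    · rintro (rfl | ⟨j, rfl⟩)
      · exact hi
      · exact mem_of_mem_erase (e j).2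
    · intro hv
      by_cases h : i = v
      · exact Or.inl h
      · exact Or.inr ⟨e.symm ⟨v, mem_erase.2 ⟨Ne.symm h, hv⟩⟩, by simp⟩
  · intro e _ e' _ h
    ext j
    simpa using congrFun h j.succ
  · intro f hf
    simp only [mem_filter, mem_univ, true_and] at hf
    obtain ⟨h0, him⟩ := hf
    have hinj : Function.Injective f := by
      rw [← Set.injOn_univ, ← coe_univ]
      exact Finset.injOn_of_card_image_eq (by rw [him, hs]; simp)
    have hmem : ∀ j : Fin n, f j.succ ∈ s.erase i := fun j =>
      mem_erase.2 ⟨fun h => Fin.succ_ne_zero j (hinj (h.trans h0.symm)),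
        him ▸ mem_image_of_mem f (mem_univ _)⟩
    refine ⟨Equiv.ofBijective (fun j => ⟨f j.succ, hmem j⟩) ?_, mem_univ _, ?_⟩
    · rw [Fintype.bijective_iff_injective_and_card]
      exact ⟨fun a b h => Fin.succ_injective _ (hinj (Subtype.ext_iff.1 h)), hcard⟩
    · ext j
      refine Fin.cases ?_ (fun j => ?_) j
      · simp [h0]
      · simp

namespace RealTensor

/-- The contraction `A x^(k-1)` for the adjacency tensor of a finite `k`-uniform family `E`: the
`(k-1)!` orderings of an edge with a prescribed first vertex cancel the normalization. -/
lemma apply_eq_sum_prod_erase {k : ℕ} [NeZero k] {V : Type*} [Fintype V]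
    [DecidableEq V] (A : RealTensor k V)
    (E : Finset (Finset V)) (hE : ∀ s ∈ E, s.card = k)
    (hA : ∀ f, A f = if univ.image f ∈ E then 1 / ((k - 1).factorial : ℝ) else 0)
    (x : V → ℝ) (i : V) :
    A.apply x i = ∑ s ∈ E with i ∈ s, ∏ v ∈ s.erase i, x v := by
  obtain ⟨n, rfl⟩ : ∃ n, k = n + 1 := ⟨k - 1, by have := NeZero.pos k; omega⟩
  have h1 : ∀ f : Fin (n + 1) → V,
      A f * ∏ j ∈ univ.erase (0 : Fin (n + 1)), x (f j) =
      ∑ s ∈ E, if univ.image f = s then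
        1 / (n.factorial : ℝ) * ∏ v ∈ s.erase (f 0), x v else 0 := by
    intro f
    rw [hA, Finset.sum_ite_eq]
    split_ifs with h
    · have hinj : Function.Injective f := by
        rw [← Set.injOn_univ, ← coe_univ]
        exact Finset.injOn_of_card_image_eq (by rw [hE _ h]; simp)
      rw [← Finset.image_erase hinj, Finset.prod_image hinj.injOn]
      simp
    · simp
  unfold apply
  rw [Finset.sum_congr rfl fun f _ => h1 f, Finset.sum_comm, Finset.sum_filter (i ∈ ·)]
  refine Finset.sum_congr rfl fun s hs => ?_
  rw [← Finset.sum_filter, Finset.filter_filter]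
  have h2 : ∀ f ∈ (univ.filter fun f : Fin (n + 1) → V => f 0 = i ∧ univ.image f = s),
      1 / (n.factorial : ℝ) * ∏ v ∈ s.erase (f 0), x v =
      1 / (n.factorial : ℝ) * ∏ v ∈ s.erase i, x v := by
    intro f hf
    rw [(mem_filter.1 hf).2.1]
  rw [Finset.sum_congr (by ext; simp) h2, Finset.sum_const]
  split_ifs with hi
  · rw [card_filter_zero_image_eq hi (hE s hs), nsmul_eq_mul, ← mul_assoc,
      mul_one_div_cancel (by positivity), one_mul]
  · rw [Finset.card_eq_zero.2, zero_smul]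
    refine filter_eq_empty_iff.2 fun f _ hf => hi ?_
    rw [← hf.1, ← hf.2]
    exact mem_image_of_mem f (mem_univ _)

end RealTensor

/-! ### The Rayleigh quotient of a uniform family -/

/-- The edge polynomial `∑ₑ ∏_{v ∈ e} x v` of a finite family `E` of finite sets. -/
def edgePoly {V : Type*} (E : Finset (Finset V)) (x : V → ℝ) : ℝ :=
  ∑ s ∈ E, ∏ v ∈ s, x v

lemma edgePoly_smul {V : Type*} {E : Finset (Finset V)} {k : ℕ} (hE : ∀ s ∈ E, s.card = k) (t : ℝ)
    (x : V → ℝ) : edgePoly E (fun v => t * x v) = t ^ k * edgePoly E x := by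
  rw [edgePoly, edgePoly, Finset.mul_sum]
  refine Finset.sum_congr rfl fun s hs => ?_
  rw [Finset.prod_mul_distrib, Finset.prod_const, hE s hs]

lemma hasDerivAt_edgePoly_update {V : Type*} [DecidableEq V] {E : Finset (Finset V)}
    (x : V → ℝ) (i : V) (t : ℝ) :
    HasDerivAt (fun t => edgePoly E (Function.update x i t))
      (∑ s ∈ E with i ∈ s, ∏ v ∈ s.erase i, x v) t := by
  unfold edgePoly
  rw [Finset.sum_filter]
  refine HasDerivAt.fun_sum fun s _ => ?_
  split_ifs with hi
  · have : (fun t => ∏ v ∈ s, Function.update x i t v) = fun t => t * ∏ v ∈ s.erase i, x v := by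
      funext t
      rw [← Finset.mul_prod_erase s _ hi, Function.update_self]
      congr 1
      exact Finset.prod_congr rfl fun v hv => Function.update_of_ne (ne_of_mem_erase hv) _ _
    rw [this]
    simpa using (hasDerivAt_id t).mul_const (∏ v ∈ s.erase i, x v)
  · have : (fun t => ∏ v ∈ s, Function.update x i t v) = fun _ => ∏ v ∈ s, x v := by
      funext t
      exact Finset.prod_congr rfl fun v hv =>
        Function.update_of_ne (by rintro rfl; exact hi hv) _ _
    rw [this]
    exact hasDerivAt_const _ _

lemma sum_pow_pos_of_ne_zero {V : Type*} [Fintype V] {k : ℕ} (hk : Even k) {x : V → ℝ}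
    (hx : x ≠ 0) : 0 < ∑ v, x v ^ k := by
  obtain ⟨v, hv⟩ := Function.ne_iff.1 hx
  exact Finset.sum_pos' (fun v _ => hk.pow_nonneg _) ⟨v, mem_univ v, hk.pow_pos hv⟩

section Variational

variable {V : Type*} [Fintype V] [DecidableEq V] {E : Finset (Finset V)} {k : ℕ}

lemma sum_mul_sum_prod_erase (hE : ∀ s ∈ E, s.card = k) (x : V → ℝ) :
    ∑ i, x i * ∑ s ∈ E with i ∈ s, ∏ v ∈ s.erase i, x v = k * edgePoly E x := by
  simp_rw [Finset.mul_sum, Finset.sum_filter]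
  rw [Finset.sum_comm, edgePoly, Finset.mul_sum]
  refine Finset.sum_congr rfl fun s hs => ?_
  rw [← Finset.sum_filter, Finset.filter_univ_mem, ← hE s hs, ← nsmul_eq_mul, ← Finset.sum_const]
  exact Finset.sum_congr rfl fun i hi => Finset.mul_prod_erase s x hi

lemma hasDerivAt_sum_pow_update (x : V → ℝ) (i : V) (t : ℝ) :
    HasDerivAt (fun t => ∑ v, Function.update x i t v ^ k) (k * t ^ (k - 1)) t := by
  have : (fun t => ∑ v, Function.update x i t v ^ k) =
      fun t => t ^ k + ∑ v ∈ univ.erase i, x v ^ k := by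
    funext t
    rw [← Finset.add_sum_erase univ _ (mem_univ i), Function.update_self]
    congr 1
    exact Finset.sum_congr rfl fun v hv => by rw [Function.update_of_ne (ne_of_mem_erase hv)]
  rw [this]
  simpa using (hasDerivAt_pow k t).add_const (∑ v ∈ univ.erase i, x v ^ k)

/-- For even `k` the form `k * edgePoly E` attains its minimum `μ` on the sphere `∑ x v ^ k = 1`. -/
lemma exists_min_edgePoly [Nonempty V] (hk : Even k) (hk0 : k ≠ 0) (hE : ∀ s ∈ E, s.card = k) :
    ∃ (μ : ℝ) (x : V → ℝ), x ≠ 0 ∧ k * edgePoly E x = μ * ∑ v, x v ^ k ∧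
      ∀ y : V → ℝ, μ * ∑ v, y v ^ k ≤ k * edgePoly E y := by
  have hnn : ∀ (x : V → ℝ) v, 0 ≤ x v ^ k := fun x v => hk.pow_nonneg _
  have hcont : Continuous fun x : V → ℝ => ∑ v, x v ^ k := by fun_prop
  have hPcont : Continuous fun x : V → ℝ => k * edgePoly E x := by
    unfold edgePoly
    fun_prop
  have hcpt : IsCompact {x : V → ℝ | ∑ v, x v ^ k = 1} := by
    refine Metric.isCompact_of_isClosed_isBounded (isClosed_eq hcont continuous_const) ?_
    refine (Metric.isBounded_closedBall (x := (0 : V → ℝ)) (r := 1)).subset fun x hx => ?_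
    rw [mem_closedBall_zero_iff, pi_norm_le_iff_of_nonneg zero_le_one]
    intro v
    have h1 : x v ^ k ≤ 1 := by
      rw [← show ∑ v, x v ^ k = 1 from hx]
      exact Finset.single_le_sum (fun v _ => hnn x v) (mem_univ v)
    rw [← hk.pow_abs] at h1
    exact (pow_le_one_iff_of_nonneg (abs_nonneg _) hk0).1 h1
  have hne : {x : V → ℝ | ∑ v, x v ^ k = 1}.Nonempty := by
    obtain ⟨v₀⟩ := ‹Nonempty V›
    refine ⟨Pi.single v₀ 1, ?_⟩
    simp only [Set.mem_ofPred_eq]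
    rw [Finset.sum_eq_single v₀] <;> simp +contextual [hk0]
  obtain ⟨x, hx, hmin⟩ := hcpt.exists_isMinOn hne hPcont.continuousOn
  refine ⟨k * edgePoly E x, x, ?_, ?_, ?_⟩
  · rintro rfl
    simp [hk0] at hx
  · rw [show ∑ v, x v ^ k = 1 from hx, mul_one]
  · intro y
    have hS : 0 ≤ ∑ v, y v ^ k := Finset.sum_nonneg fun v _ => hnn y v
    rcases hS.eq_or_lt with h0 | hpos
    · have hy : y = 0 := by
        funext v
        exact eq_zero_of_pow_eq_zero
          ((Finset.sum_eq_zero_iff_of_nonneg fun v _ => hnn y v).1 h0.symm v (mem_univ v))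
      have : edgePoly E y = 0 := by
        have := edgePoly_smul hE 0 y
        rw [zero_pow hk0, zero_mul] at this
        rw [← this, hy]
        congr 1
        simp [funext_iff]
      rw [← h0, this]
      simp
    · -- Rescale `y` to the sphere.
      set S := ∑ v, y v ^ k with hSdef
      set t : ℝ := S ^ (-(k : ℝ)⁻¹) with ht
      have htk : t ^ k = S⁻¹ := by
        rw [ht, Real.rpow_neg hpos.le, inv_pow, Real.rpow_inv_natCast_pow hpos.le hk0]
      have hmem : (fun v => t * y v) ∈ {x : V → ℝ | ∑ v, x v ^ k = 1} := by
        simp only [Set.mem_ofPred_eq, mul_pow, ← Finset.mul_sum, htk]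
        exact inv_mul_cancel₀ hpos.ne'
      have := hmin hmem
      simp only [Set.mem_ofPred_eq, edgePoly_smul hE, htk] at this
      calc k * edgePoly E x * S ≤ k * (S⁻¹ * edgePoly E y) * S :=
            mul_le_mul_of_nonneg_right this hpos.le
        _ = k * edgePoly E y := by field_simp

/-- A global minimum of the Rayleigh quotient is a critical point, hence an eigenvector. -/
lemma sum_prod_erase_eq_of_min (hk0 : k ≠ 0) {μ : ℝ} {x : V → ℝ}
    (hx : k * edgePoly E x = μ * ∑ v, x v ^ k)
    (hmin : ∀ y : V → ℝ, μ * ∑ v, y v ^ k ≤ k * edgePoly E y) (i : V) :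
    ∑ s ∈ E with i ∈ s, ∏ v ∈ s.erase i, x v = μ * x i ^ (k - 1) := by
  have hder := ((hasDerivAt_edgePoly_update (E := E) x i (x i)).const_mul (k : ℝ)).sub
    ((hasDerivAt_sum_pow_update (k := k) x i (x i)).const_mul μ)
  have hloc : IsLocalMin ((fun t => k * edgePoly E (Function.update x i t)) -
      fun t => μ * ∑ v, Function.update x i t v ^ k) (x i) := by
    refine Filter.Eventually.of_forall fun t => ?_
    have := hmin (Function.update x i t)
    simp only [Pi.sub_apply, Function.update_eq_self, hx, sub_self]
    linarith
  have h0 := hloc.hasDerivAt_eq_zero hder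
  have hk' : (k : ℝ) ≠ 0 := Nat.cast_ne_zero.2 hk0
  apply mul_left_cancel₀ hk'
  linarith

end Variational

namespace RealTensor

/-- For even `k`, the adjacency tensor of a finite `k`-uniform family has a least H-eigenvalue, and
it is the minimum of the Rayleigh quotient. -/
lemma exists_isLeast_isHEigenvalue {k : ℕ} [NeZero k] (hk : Even k) {V : Type*} [Fintype V]
    [DecidableEq V] [Nonempty V] (A : RealTensor k V) (E : Finset (Finset V))
    (hE : ∀ s ∈ E, s.card = k)
    (hA : ∀ f, A f = if univ.image f ∈ E then 1 / ((k - 1).factorial : ℝ) else 0) :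
    ∃ μ, IsLeast {μ : ℝ | A.IsHEigenvalue μ} μ ∧ ∃ x : V → ℝ, x ≠ 0 ∧
      k * edgePoly E x = μ * ∑ v, x v ^ k := by
  obtain ⟨μ, x, hx0, hx, hmin⟩ := exists_min_edgePoly hk (NeZero.ne k) hE
  refine ⟨μ, ⟨⟨x, hx0, fun i => ?_⟩, ?_⟩, x, hx0, hx⟩
  · rw [apply_eq_sum_prod_erase A E hE hA]
    exact sum_prod_erase_eq_of_min (NeZero.ne k) hx hmin i
  · rintro ν ⟨y, hy0, hy⟩
    have hsum : k * edgePoly E y = ν * ∑ v, y v ^ k := by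
      rw [← sum_mul_sum_prod_erase hE, Finset.mul_sum]
      refine Finset.sum_congr rfl fun i _ => ?_
      rw [← apply_eq_sum_prod_erase A E hE hA, hy i, mul_left_comm,
        mul_pow_sub_one (NeZero.ne k)]
    exact le_of_mul_le_mul_right (hsum ▸ hmin y) (sum_pow_pos_of_ne_zero hk hy0)

end RealTensor

/-! ### Hypergraphs as finite families of finite sets -/

namespace Hypergraph

open Classical in
/-- The edges of a hypergraph with finitely many vertices, as finite sets of vertices. -/
noncomputable def finEdges {α : Type*} (T : Hypergraph α) [Fintype T.vertexSet] :
    Finset (Finset T.vertexSet) :=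
  univ.filter fun s => Subtype.val '' (s : Set T.vertexSet) ∈ T.edgeSet

variable {α : Type*} {T : Hypergraph α} [Fintype T.vertexSet]

lemma mem_finEdges {s : Finset T.vertexSet} :
    s ∈ T.finEdges ↔ Subtype.val '' (s : Set T.vertexSet) ∈ T.edgeSet := by
  simp [finEdges]

lemma exists_mem_finEdges {e : Set α} (he : e ∈ T.edgeSet) :
    ∃ s ∈ T.finEdges, Subtype.val '' (s : Set T.vertexSet) = e := by
  classical
  have h : Subtype.val '' ((univ.filter fun v : T.vertexSet => v.1 ∈ e : Finset T.vertexSet) :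
      Set T.vertexSet) = e := by
    ext v
    simp only [coe_filter, mem_univ, true_and, Set.mem_image, Set.mem_ofPred_eq, Subtype.exists,
      exists_and_left, exists_prop, exists_eq_right_right]
    exact ⟨fun h => h.1, fun h => ⟨h, mem_vertexSet_of_mem_edgeSet he h⟩⟩
  exact ⟨_, mem_finEdges.2 (by rwa [h]), h⟩

lemma card_of_mem_finEdges {k : ℕ} (hT : T.IsUniformOfSize k) {s : Finset T.vertexSet}
    (hs : s ∈ T.finEdges) : s.card = k := by
  have := hT _ (mem_finEdges.1 hs)
  rwa [Set.ncard_image_of_injective _ Subtype.val_injective, Set.ncard_coe_finset] at this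

lemma card_finEdges : T.finEdges.card = T.edgeSet.ncard := by
  rw [← Set.ncard_coe_finset]
  refine Set.ncard_congr (fun s _ => Subtype.val '' (s : Set T.vertexSet))
    (fun s hs => mem_finEdges.1 (mem_coe.1 hs)) (fun s t _ _ h => ?_) (fun e he => ?_)
  · exact Finset.coe_injective (Subtype.val_injective.image_injective h)
  · obtain ⟨s, hs, h⟩ := exists_mem_finEdges he
    exact ⟨s, mem_coe.2 hs, h⟩

lemma adjacencyTensor_eq [DecidableEq T.vertexSet] (k : ℕ) (f : Fin k → T.vertexSet) :
    T.adjacencyTensor k f =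
      if univ.image f ∈ T.finEdges then 1 / ((k - 1).factorial : ℝ) else 0 := by
  have h : Subtype.val '' ((univ.image f : Finset T.vertexSet) : Set T.vertexSet) =
      Set.range fun j => (f j : α) := by
    rw [coe_image, coe_univ, Set.image_univ, ← Set.range_comp]
    rfl
  have h' : univ.image f ∈ T.finEdges ↔ (Set.range fun j => (f j : α)) ∈ T.edgeSet := by
    rw [mem_finEdges, h]
  classical
  exact if_congr h'.symm rfl rfl

lemma adjacencyTensor_apply [DecidableEq T.vertexSet] {k : ℕ} [NeZero k]
    (hT : T.IsUniformOfSize k) (x : T.vertexSet → ℝ)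
    (i : T.vertexSet) :
    (T.adjacencyTensor k).apply x i =
      ∑ s ∈ T.finEdges with i ∈ s, ∏ v ∈ s.erase i, x v :=
  RealTensor.apply_eq_sum_prod_erase _ _ (fun _ => card_of_mem_finEdges hT)
    (adjacencyTensor_eq k) x i

/-- The least H-eigenvalue of an even-order adjacency tensor exists and is the value of the
Rayleigh quotient at some nonzero vector. -/
lemma isLeast_leastEigenvalue {k : ℕ} [NeZero k] (hk : Even k) (hT : T.IsUniformOfSize k)
    (hne : T.vertexSet.Nonempty) :
    IsLeast {μ : ℝ | (T.adjacencyTensor k).IsHEigenvalue μ} (T.leastEigenvalue k) ∧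
      ∃ x : T.vertexSet → ℝ, x ≠ 0 ∧
        k * edgePoly T.finEdges x = T.leastEigenvalue k * ∑ v, x v ^ k := by
  classical
  have := hne.to_subtype
  obtain ⟨μ, hμ, hx⟩ := RealTensor.exists_isLeast_isHEigenvalue hk _ T.finEdges
    (fun _ => card_of_mem_finEdges hT) (adjacencyTensor_eq k)
  have h : T.leastEigenvalue k = μ := hμ.csInf_eq
  rw [h]
  exact ⟨hμ, hx⟩

end Hypergraph

/-! ### The incidence tree of a hypertree -/

namespace SimpleGraph

variable {W : Type*} {G : SimpleGraph W}

/-- In a tree, at most one neighbour of `u` is closer than `u` to a given vertex. -/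
lemma IsTree.eq_of_adj_of_dist_lt (hG : G.IsTree) {w u a b : W} (ha : G.Adj u a) (hb : G.Adj u b)
    (hwa : G.dist w a < G.dist w u) (hwb : G.dist w b < G.dist w u) : a = b := by
  obtain ⟨P, hP⟩ := (hG.existsUnique_path w u).exists
  have key : ∀ c, G.Adj u c → G.dist w c < G.dist w u → c = P.penultimate := by
    intro c hc hwc
    obtain ⟨p, hp, hlen⟩ := (hG.connected w c).exists_path_of_dist
    have hq : (p.concat hc.symm).IsPath := by
      apply Walk.isPath_of_length_eq_dist
      have := SimpleGraph.dist_le (p.concat hc.symm)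
      rw [Walk.length_concat] at this ⊢
      omega
    have := (hG.existsUnique_path w u).unique hq hP
    rw [← this, Walk.penultimate_concat]
  rw [key a ha hwa, key b hb hwb]

end SimpleGraph

/-- The bipartite incidence graph of a finite family of finite sets: a point `v` is joined to a
member `s` if `v ∈ s`. -/
def incidenceGraph {V : Type*} (E : Finset (Finset V)) : SimpleGraph (V ⊕ E) where
  Adj
    | .inl v, .inr s => v ∈ s.1
    | .inr s, .inl v => v ∈ s.1
    | _, _ => False
  symm := ⟨by rintro (v | s) (w | t) h <;> exact h⟩
  loopless := ⟨by rintro (v | s) h <;> exact h⟩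

section Incidence

variable {V : Type*} {E : Finset (Finset V)}

@[simp] lemma not_incidenceGraph_adj_inl_inl {v w : V} :
    ¬ (incidenceGraph E).Adj (.inl v) (.inl w) := id

@[simp] lemma not_incidenceGraph_adj_inr_inr {s t : E} :
    ¬ (incidenceGraph E).Adj (.inr s) (.inr t) := id

lemma isLeft_getVert_iff {v : V} {y : V ⊕ E} (p : (incidenceGraph E).Walk (.inl v) y) {i : ℕ}
    (hi : i ≤ p.length) : (p.getVert i).isLeft ↔ Even i := by
  induction i with
  | zero => simp
  | succ i ih =>
    have hadj := p.adj_getVert_succ (i := i) (by omega)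
    have ih := ih (by omega)
    rw [Nat.even_add_one, ← ih]
    rcases h1 : p.getVert i with a | s <;> rcases h2 : p.getVert (i + 1) with b | t <;>
      simp_all

/-- A cycle of the incidence graph through a point alternates between points and sets; reading off
its even and odd positions gives a Berge cycle. -/
lemma exists_berge_of_isCycle {v₀ : V} {p : (incidenceGraph E).Walk (.inl v₀) (.inl v₀)}
    (hp : p.IsCycle) :
    ∃ (n : ℕ) (v : Fin (n + 2) → V) (e : Fin (n + 2) → E), Function.Injective v ∧
      Function.Injective e ∧ ∀ i, v i ∈ (e i).1 ∧ v (i + 1) ∈ (e i).1 := by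
  have hL := hp.three_le_length
  have heven : Even p.length := by
    rw [← isLeft_getVert_iff p le_rfl, p.getVert_length]
    rfl
  obtain ⟨n, hn⟩ : ∃ n, p.length = 2 * (n + 2) := by
    obtain ⟨l, hl⟩ := heven
    exact ⟨l - 2, by omega⟩
  have hv : ∀ i : ℕ, i ≤ n + 2 → ∃ v, p.getVert (2 * i) = .inl v := fun i hi =>
    Sum.isLeft_iff.1 ((isLeft_getVert_iff p (by omega)).2 (even_two_mul i))
  have he : ∀ i : Fin (n + 2), ∃ e, p.getVert (2 * i.1 + 1) = .inr e := fun i => by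
    have h := (isLeft_getVert_iff p (i := 2 * i.1 + 1) (by omega)).not.2
      (Nat.not_even_iff_odd.2 (odd_two_mul_add_one i.1))
    exact Sum.isRight_iff.1 (by simpa using h)
  choose v hv using fun i : Fin (n + 2) => hv i.1 i.2.le
  choose e he using he
  have hnext : ∀ i : Fin (n + 2), p.getVert (2 * i.1 + 1 + 1) = .inl (v (i + 1)) := by
    intro i
    rw [← hv]
    by_cases h : i.1 = n + 1
    · have : i + 1 = 0 := by
        apply Fin.ext
        rw [Fin.val_add_one]
        simp [Fin.ext_iff, h]
      rw [this, show 2 * i.1 + 1 + 1 = p.length by omega, p.getVert_length]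
      simp
    · have : (i + 1).1 = i.1 + 1 := by
        rw [Fin.val_add_one]
        simp [Fin.ext_iff, h]
      rw [this]
      rfl
  refine ⟨n, v, e, fun i j h => ?_, fun i j h => ?_, fun i => ⟨?_, ?_⟩⟩
  · have h' : p.getVert (2 * i.1) = p.getVert (2 * j.1) := by rw [hv, hv, h]
    have := hp.getVert_injOn' (show 2 * i.1 ≤ p.length - 1 by omega)
      (show 2 * j.1 ≤ p.length - 1 by omega) h'
    omega
  · have h' : p.getVert (2 * i.1 + 1) = p.getVert (2 * j.1 + 1) := by rw [he, he, h]
    have := hp.getVert_injOn' (show 2 * i.1 + 1 ≤ p.length - 1 by omega)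
      (show 2 * j.1 + 1 ≤ p.length - 1 by omega) h'
    omega
  · have := p.adj_getVert_succ (i := 2 * i.1) (by omega)
    rwa [hv, he] at this
  · have := p.adj_getVert_succ (i := 2 * i.1 + 1) (by omega)
    rwa [hnext, he] at this

end Incidence

namespace Hypergraph

variable {α : Type*} {T : Hypergraph α} [Fintype T.vertexSet]

lemma isAcyclic_incidenceGraph (hT : ¬ T.HasCycle) : (incidenceGraph T.finEdges).IsAcyclic := by
  classical
  have key : ∀ v (p : (incidenceGraph T.finEdges).Walk (.inl v) (.inl v)), ¬ p.IsCycle := by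
    intro v₀ p hp
    obtain ⟨n, v, e, hv, he, h⟩ := exists_berge_of_isCycle hp
    refine hT ⟨n, fun i => (v i).1, fun i => Subtype.val '' ((e i).1 : Set T.vertexSet),
      Subtype.val_injective.comp hv, ?_, fun i => ⟨mem_finEdges.1 (e i).2,
        Set.mem_image_of_mem _ (h i).1, Set.mem_image_of_mem _ (h i).2⟩⟩
    exact (Subtype.val_injective.image_injective.comp Finset.coe_injective).comp
      (Subtype.val_injective.comp he)
  rintro (v | s) p hp
  · exact key v p hp
  · have hadj : (incidenceGraph T.finEdges).Adj (.inr s) p.snd :=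
      p.adj_snd hp.not_nil
    rcases hsnd : p.snd with v | t
    · have hmem : (Sum.inl v) ∈ p.support := hsnd ▸ p.getVert_mem_support 1
      exact key v _ (hp.rotate hmem)
    · rw [hsnd] at hadj
      exact hadj

lemma isTree_incidenceGraph {k : ℕ} (hk : k ≠ 0) (hu : T.IsUniformOfSize k)
    (hT : T.IsHypertree) : (incidenceGraph T.finEdges).IsTree := by
  refine ⟨?_, isAcyclic_incidenceGraph hT.2⟩
  obtain ⟨⟨v₀, hv₀⟩, hconn⟩ := hT.1
  have hvert : ∀ v : T.vertexSet,
      (incidenceGraph T.finEdges).Reachable (.inl ⟨v₀, hv₀⟩) (.inl v) := by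
    rintro ⟨v, hv⟩
    have h := hconn v₀ hv₀ v hv
    clear hconn
    induction h with
    | refl => exact SimpleGraph.Reachable.refl _
    | @tail b c hbc hadj ih =>
      obtain ⟨e, he, hb, hc⟩ := hadj
      have hbV := mem_vertexSet_of_mem_edgeSet he hb
      obtain ⟨s, hs, rfl⟩ := exists_mem_finEdges he
      have hb' : (⟨b, hbV⟩ : T.vertexSet) ∈ s := by simpa [hbV] using hb
      have hc' : (⟨c, hv⟩ : T.vertexSet) ∈ s := by simpa [hv] using hc
      refine (ih hbV).trans (SimpleGraph.Reachable.trans (v := .inr ⟨s, hs⟩) ?_ ?_)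
      · exact SimpleGraph.Adj.reachable hb'
      · exact SimpleGraph.Adj.reachable hc'
  have hall : ∀ x, (incidenceGraph T.finEdges).Reachable (.inl ⟨v₀, hv₀⟩) x := by
    rintro (v | s)
    · exact hvert v
    · obtain ⟨v, hv⟩ : s.1.Nonempty := by
        rw [← Finset.card_pos, card_of_mem_finEdges hu s.2]
        omega
      exact (hvert v).trans (SimpleGraph.Adj.reachable hv)
  have : Nonempty (T.vertexSet ⊕ T.finEdges) := ⟨.inl ⟨v₀, hv₀⟩⟩
  exact ⟨fun x y => (hall x).symm.trans (hall y)⟩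

end Hypergraph

/-! ### Branch sizes in a hypertree -/

section BranchSize

variable {V : Type*} {E : Finset (Finset V)}

/-- The number of members of `E` that are closer to `s` than to `v` in the incidence graph. If that
graph is a tree and `v ∈ s`, these are the members on the side of `s` once the incidence of `v` and
`s` is removed. -/
noncomputable def branchSize (E : Finset (Finset V)) (v : V) (s : E) : ℕ :=
  #{f : E | (incidenceGraph E).dist (.inr f) (.inr s) < (incidenceGraph E).dist (.inr f) (.inl v)}

lemma branchSize_le (v : V) (s : E) : branchSize E v s ≤ #E := by
  simpa [branchSize] using Finset.card_le_univ (α := E) _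

lemma branchSize_pos (hE : (incidenceGraph E).IsTree) (v : V) (s : E) : 0 < branchSize E v s := by
  refine Finset.card_pos.2 ⟨s, mem_filter.2 ⟨mem_univ _, ?_⟩⟩
  rw [SimpleGraph.dist_self]
  exact hE.connected.pos_dist_of_ne (by simp)

/-- The branches at a point are disjoint. -/
lemma sum_branchSize_le [DecidableEq V] (hE : (incidenceGraph E).IsTree) (v : V) :
    ∑ s : E with v ∈ s.1, branchSize E v s ≤ #E := by
  unfold branchSize
  rw [← Finset.card_biUnion]
  · simpa using Finset.card_le_univ (α := E) _
  · intro s hs t ht hst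
    rw [Function.onFun, Finset.disjoint_filter]
    intro f _ h1 h2
    have := hE.eq_of_adj_of_dist_lt (w := .inr f) (u := .inl v) (a := .inr s) (b := .inr t)
      (mem_filter.1 hs).2 (mem_filter.1 ht).2 h1 h2
    exact hst (Sum.inr_injective this)

lemma card_sub_branchSize (hE : (incidenceGraph E).IsTree) {v : V} {s : E} (hv : v ∈ s.1) :
    #E - branchSize E v s = #{f : E | (incidenceGraph E).dist (.inr f) (.inl v) <
      (incidenceGraph E).dist (.inr f) (.inr s)} := by
  have h := Finset.card_filter_add_card_filter_not (s := (univ : Finset E)) (fun f =>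
    (incidenceGraph E).dist (.inr f) (.inr s) < (incidenceGraph E).dist (.inr f) (.inl v))
  rw [Finset.card_univ, Fintype.card_coe] at h
  have h2 : ∀ f : E, ¬ (incidenceGraph E).dist (.inr f) (.inr s) <
      (incidenceGraph E).dist (.inr f) (.inl v) ↔ (incidenceGraph E).dist (.inr f) (.inl v) <
      (incidenceGraph E).dist (.inr f) (.inr s) := fun f => by
    have := hE.dist_ne_of_adj (.inr f) (v := .inl v) (w := .inr s) hv
    omega
  simp only [h2] at h
  unfold branchSize
  omega

/-- The other members of `E`, seen from `s`, split into the parts hanging off the points of `s`. -/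
lemma sum_card_sub_branchSize_lt (hE : (incidenceGraph E).IsTree) (s : E) :
    ∑ v ∈ s.1, (#E - branchSize E v s) < #E := by
  classical
  rw [Finset.sum_congr rfl fun v hv => card_sub_branchSize hE hv, ← Finset.card_biUnion]
  · have : #E = #(univ : Finset E) := by simp
    rw [this]
    refine Finset.card_lt_card ((Finset.ssubset_univ_iff).2 fun h => ?_)
    have hs := h ▸ mem_univ s
    simp at hs
  · intro v hv w hw hvw
    rw [Function.onFun, Finset.disjoint_filter]
    intro f _ h1 h2
    have := hE.eq_of_adj_of_dist_lt (w := .inr f) (u := .inr s) (a := .inl v) (b := .inl w)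
      hv hw h1 h2
    exact hvw (Sum.inl_injective this)

lemma branchSize_lt_of_mem (hE : (incidenceGraph E).IsTree) {v : V} {s t : E} (hst : s ≠ t)
    (hs : v ∈ s.1) (ht : v ∈ t.1) : branchSize E v s < #E := by
  classical
  have h1 := sum_branchSize_le hE v
  have h2 : branchSize E v s + branchSize E v t ≤ ∑ s : E with v ∈ s.1, branchSize E v s := by
    rw [← Finset.sum_pair hst]
    exact Finset.sum_le_sum_of_subset (by intro x; simp; rintro (rfl | rfl) <;> assumption)
  have := branchSize_pos hE v t
  omega

end BranchSize

/-! ### Two elementary inequalities -/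

lemma Finset.one_sub_sum_le_prod_one_sub {ι : Type*} (s : Finset ι) (a : ι → ℝ)
    (h0 : ∀ i ∈ s, 0 ≤ a i) (h1 : ∀ i ∈ s, a i ≤ 1) :
    1 - ∑ i ∈ s, a i ≤ ∏ i ∈ s, (1 - a i) := by
  classical
  induction s using Finset.induction_on with
  | empty => simp
  | insert i s hi ih =>
    rw [Finset.sum_insert hi, Finset.prod_insert hi]
    have ih := ih (fun j hj => h0 j (mem_insert_of_mem hj)) fun j hj => h1 j (mem_insert_of_mem hj)
    have hs : 0 ≤ ∑ j ∈ s, a j := Finset.sum_nonneg fun j hj => h0 j (mem_insert_of_mem hj)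
    have hi0 := h0 i (mem_insert_self _ _)
    have hi1 := h1 i (mem_insert_self _ _)
    nlinarith [mul_le_mul_of_nonneg_left ih (sub_nonneg.2 hi1), mul_nonneg hi0 hs]

/-- Weierstrass' product inequality is strict as soon as two of the numbers are positive. -/
lemma Finset.one_sub_sum_lt_prod_one_sub {ι : Type*} (s : Finset ι) (a : ι → ℝ)
    (h0 : ∀ i ∈ s, 0 ≤ a i) (h1 : ∀ i ∈ s, a i < 1) {i j : ι} (hi : i ∈ s) (hj : j ∈ s)
    (hij : i ≠ j) (hai : 0 < a i) (haj : 0 < a j) :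
    1 - ∑ i ∈ s, a i < ∏ i ∈ s, (1 - a i) := by
  classical
  have hj' : j ∈ s.erase i := mem_erase.2 ⟨hij.symm, hj⟩
  rw [← Finset.add_sum_erase _ _ hi, ← Finset.mul_prod_erase _ _ hi,
    ← Finset.add_sum_erase _ _ hj', ← Finset.mul_prod_erase _ _ hj']
  have hmem : ∀ l ∈ (s.erase i).erase j, l ∈ s := fun l hl =>
    mem_of_mem_erase (mem_of_mem_erase hl)
  have hw := Finset.one_sub_sum_le_prod_one_sub ((s.erase i).erase j) a
    (fun l hl => h0 l (hmem l hl)) fun l hl => (h1 l (hmem l hl)).le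
  have hS : 0 ≤ ∑ l ∈ (s.erase i).erase j, a l := Finset.sum_nonneg fun l hl => h0 l (hmem l hl)
  have hP : 0 < ∏ l ∈ (s.erase i).erase j, (1 - a l) :=
    Finset.prod_pos fun l hl => sub_pos.2 (h1 l (hmem l hl))
  have hi1 := h1 i hi
  have hj1 := h1 j hj
  set S := ∑ l ∈ (s.erase i).erase j, a l
  set P := ∏ l ∈ (s.erase i).erase j, (1 - a l)
  have h2 : (1 - a i) * (1 - a j) * (1 - S) ≤ (1 - a i) * ((1 - a j) * P) := by
    rw [mul_assoc]
    exact mul_le_mul_of_nonneg_left (mul_le_mul_of_nonneg_left hw (by linarith)) (by linarith)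
  rcases le_or_gt S 1 with hS1 | hS1
  · rcases hS1.lt_or_eq with hS1 | hS1
    · nlinarith [mul_pos (mul_pos hai haj) (sub_pos.2 hS1), mul_nonneg hai.le hS,
        mul_nonneg haj.le hS]
    · have := mul_pos (sub_pos.2 hi1) (mul_pos (sub_pos.2 hj1) hP)
      linarith
  · have := mul_pos (sub_pos.2 hi1) (mul_pos (sub_pos.2 hj1) hP)
    linarith

/-- The inequality of arithmetic and geometric means, without roots. -/
lemma Finset.card_pow_mul_prod_le_sum_pow {ι : Type*} (s : Finset ι) (a : ι → ℝ)
    (h0 : ∀ i ∈ s, 0 ≤ a i) : (#s : ℝ) ^ #s * ∏ i ∈ s, a i ≤ (∑ i ∈ s, a i) ^ #s := by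
  rcases s.eq_empty_or_nonempty with rfl | hs
  · simp
  have hc0 : #s ≠ 0 := hs.card_pos.ne'
  have hc : (0 : ℝ) < #s := by exact_mod_cast hs.card_pos
  have h := Real.geom_mean_le_arith_mean_weighted s (fun _ => (#s : ℝ)⁻¹) a
    (fun _ _ => by positivity) (by rw [Finset.sum_const, nsmul_eq_mul, mul_inv_cancel₀ hc.ne']) h0
  have h' := pow_le_pow_left₀
    (Finset.prod_nonneg fun i hi => Real.rpow_nonneg (h0 i hi) _) h #s
  rw [← Finset.prod_pow, Finset.prod_congr rfl fun i hi =>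
    Real.rpow_inv_natCast_pow (h0 i hi) hc0, ← Finset.mul_sum, mul_pow, inv_pow] at h'
  calc (#s : ℝ) ^ #s * ∏ i ∈ s, a i
      ≤ (#s : ℝ) ^ #s * (((#s : ℝ) ^ #s)⁻¹ * (∑ i ∈ s, a i) ^ #s) := by gcongr
    _ = (∑ i ∈ s, a i) ^ #s := by rw [mul_inv_cancel_left₀ (by positivity)]

/-! ### The bound on the Rayleigh quotient and its equality case -/

section SpectralBound

variable {V : Type*} {E : Finset (Finset V)}

/-- The normalized branch sizes. They are a weighting of the incidences with total weight at most
`1` at every point and product at least `1 / #E` over every member of `E`. -/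
noncomputable def branchWeight (E : Finset (Finset V)) (v : V) (s : E) : ℝ :=
  branchSize E v s / #E

lemma branchWeight_pos (hE : (incidenceGraph E).IsTree) (v : V) (s : E) :
    0 < branchWeight E v s :=
  div_pos (Nat.cast_pos.2 (branchSize_pos hE v s))
    (Nat.cast_pos.2 (Finset.card_pos.2 ⟨s.1, s.2⟩))

lemma sum_branchWeight_le [DecidableEq V] (hE : (incidenceGraph E).IsTree) (v : V) :
    ∑ s : E with v ∈ s.1, branchWeight E v s ≤ 1 := by
  unfold branchWeight
  rw [← Finset.sum_div]
  refine div_le_one_of_le₀ ?_ (by positivity)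
  exact_mod_cast sum_branchSize_le hE v

lemma one_sub_branchWeight (v : V) (s : E) :
    1 - branchWeight E v s = ((#E - branchSize E v s : ℕ) : ℝ) / #E := by
  have : (#E : ℝ) ≠ 0 := Nat.cast_ne_zero.2 (Finset.card_pos.2 ⟨s.1, s.2⟩).ne'
  rw [Nat.cast_sub (branchSize_le v s), branchWeight, sub_div, div_self this]

lemma inv_card_le_one_sub_sum (hE : (incidenceGraph E).IsTree) (s : E) :
    (#E : ℝ)⁻¹ ≤ 1 - ∑ v ∈ s.1, (1 - branchWeight E v s) := by
  have hpos : (0 : ℝ) < #E := Nat.cast_pos.2 (Finset.card_pos.2 ⟨s.1, s.2⟩)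
  simp only [one_sub_branchWeight]
  rw [← Finset.sum_div, ← Nat.cast_sum, le_sub_iff_add_le, ← one_div, ← add_div,
    div_le_one hpos]
  have := sum_card_sub_branchSize_lt hE s
  exact_mod_cast (by omega : 1 + ∑ v ∈ s.1, (#E - branchSize E v s) ≤ #E)

lemma inv_card_le_prod_branchWeight (hE : (incidenceGraph E).IsTree) (s : E) :
    (#E : ℝ)⁻¹ ≤ ∏ v ∈ s.1, branchWeight E v s := by
  refine (inv_card_le_one_sub_sum hE s).trans ((Finset.one_sub_sum_le_prod_one_sub s.1
    (fun v => 1 - branchWeight E v s) (fun v _ => ?_) fun v _ => ?_).trans_eq (by simp))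
  · rw [one_sub_branchWeight]
    positivity
  · linarith [branchWeight_pos hE v s]

/-- The product bound is strict on a member of `E` with two points that lie in further members. -/
lemma inv_card_lt_prod_branchWeight (hE : (incidenceGraph E).IsTree) {s t u : E} {v w : V}
    (hvw : v ≠ w) (hvs : v ∈ s.1) (hws : w ∈ s.1) (hst : s ≠ t) (hvt : v ∈ t.1) (hsu : s ≠ u)
    (hwu : w ∈ u.1) : (#E : ℝ)⁻¹ < ∏ v ∈ s.1, branchWeight E v s := by
  classical
  have hpos : (0 : ℝ) < #E := Nat.cast_pos.2 (Finset.card_pos.2 ⟨s.1, s.2⟩)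
  have key : ∀ {v : V} {t : E}, s ≠ t → v ∈ s.1 → v ∈ t.1 → 0 < 1 - branchWeight E v s := by
    intro v t hst hs ht
    rw [one_sub_branchWeight]
    have := branchSize_lt_of_mem hE hst hs ht
    exact div_pos (Nat.cast_pos.2 (by omega)) hpos
  refine (inv_card_le_one_sub_sum hE s).trans_lt ((Finset.one_sub_sum_lt_prod_one_sub s.1
    (fun v => 1 - branchWeight E v s) (fun v _ => ?_) (fun v _ => ?_) hvs hws hvw
    (key hst hvs hvt) (key hsu hws hwu)).trans_eq (by simp))
  · rw [one_sub_branchWeight]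
    positivity
  · linarith [branchWeight_pos hE v s]

lemma pow_card_mul_prod_branchWeight_le (hE : (incidenceGraph E).IsTree) {k : ℕ} (s : E)
    (hs : #s.1 = k) (x : V → ℝ) :
    (k * ∏ v ∈ s.1, |x v|) ^ k * ∏ v ∈ s.1, branchWeight E v s ≤
      (∑ v ∈ s.1, branchWeight E v s * |x v| ^ k) ^ k := by
  have h := Finset.card_pow_mul_prod_le_sum_pow s.1 (fun v => branchWeight E v s * |x v| ^ k)
    fun v _ => mul_nonneg (branchWeight_pos hE v s).le (by positivity)
  rw [hs, Finset.prod_mul_distrib, Finset.prod_pow] at h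
  rw [mul_pow, mul_assoc, mul_comm (_ ^ k) (∏ v ∈ s.1, branchWeight E v s)]
  exact h

lemma card_mul_prod_abs_le (hE : (incidenceGraph E).IsTree) {k : ℕ} (hk : k ≠ 0) {r : ℝ}
    (hr : 0 ≤ r) (hrk : r ^ k = #E) (s : E) (hs : #s.1 = k) (x : V → ℝ) :
    k * ∏ v ∈ s.1, |x v| ≤ r * ∑ v ∈ s.1, branchWeight E v s * |x v| ^ k := by
  have hpos : (0 : ℝ) < #E := Nat.cast_pos.2 (Finset.card_pos.2 ⟨s.1, s.2⟩)
  have hS : 0 ≤ ∑ v ∈ s.1, branchWeight E v s * |x v| ^ k :=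
    Finset.sum_nonneg fun v _ => mul_nonneg (branchWeight_pos hE v s).le (by positivity)
  refine le_of_pow_le_pow_left₀ hk (mul_nonneg hr hS) ?_
  rw [mul_pow r, hrk, ← inv_mul_le_iff₀ hpos, mul_comm]
  refine le_trans ?_ (pow_card_mul_prod_branchWeight_le hE s hs x)
  exact mul_le_mul_of_nonneg_left (inv_card_le_prod_branchWeight hE s) (by positivity)

lemma card_mul_prod_abs_lt (hE : (incidenceGraph E).IsTree) {k : ℕ} {r : ℝ}
    (hr : 0 ≤ r) (hrk : r ^ k = #E) (s : E) (hs : #s.1 = k) {x : V → ℝ} (hx : ∀ v ∈ s.1, x v ≠ 0)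
    (hk : k ≠ 0) (hlt : (#E : ℝ)⁻¹ < ∏ v ∈ s.1, branchWeight E v s) :
    k * ∏ v ∈ s.1, |x v| < r * ∑ v ∈ s.1, branchWeight E v s * |x v| ^ k := by
  have hpos : (0 : ℝ) < #E := Nat.cast_pos.2 (Finset.card_pos.2 ⟨s.1, s.2⟩)
  have hS : 0 ≤ ∑ v ∈ s.1, branchWeight E v s * |x v| ^ k :=
    Finset.sum_nonneg fun v _ => mul_nonneg (branchWeight_pos hE v s).le (by positivity)
  have hP : 0 < k * ∏ v ∈ s.1, |x v| :=
    mul_pos (Nat.cast_pos.2 (Nat.pos_of_ne_zero hk))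
      (Finset.prod_pos fun v hv => abs_pos.2 (hx v hv))
  refine lt_of_pow_lt_pow_left₀ k (mul_nonneg hr hS) ?_
  rw [mul_pow r, hrk, ← inv_mul_lt_iff₀ hpos, mul_comm]
  refine lt_of_lt_of_le ?_ (pow_card_mul_prod_branchWeight_le hE s hs x)
  exact mul_lt_mul_of_pos_left hlt (by positivity)

lemma sum_sum_branchWeight_mul_le [Fintype V] (hE : (incidenceGraph E).IsTree) {y : V → ℝ}
    (hy : ∀ v, 0 ≤ y v) : ∑ s : E, ∑ v ∈ s.1, branchWeight E v s * y v ≤ ∑ v, y v := by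
  classical
  have h1 : ∀ s : E, ∑ v ∈ s.1, branchWeight E v s * y v =
      ∑ v, if v ∈ s.1 then branchWeight E v s * y v else 0 := fun s => by
    rw [← Finset.sum_filter, Finset.filter_univ_mem]
  rw [Finset.sum_congr rfl fun s _ => h1 s, Finset.sum_comm]
  refine Finset.sum_le_sum fun v _ => ?_
  rw [← Finset.sum_filter, ← Finset.sum_mul]
  exact mul_le_of_le_one_left (hy v) (sum_branchWeight_le hE v)

/-- The sum over the members of `E` of the gaps in the weighted inequality of arithmetic and
geometric means bounds from below the excess of a Rayleigh quotient over `-r`. -/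
lemma sum_gap_le [Fintype V] (hE : (incidenceGraph E).IsTree) {k : ℕ} (hk : Even k) {r μ : ℝ}
    (hr : 0 ≤ r) {x : V → ℝ} (hx : k * edgePoly E x = μ * ∑ v, x v ^ k) :
    ∑ s : E, (r * ∑ v ∈ s.1, branchWeight E v s * |x v| ^ k - k * ∏ v ∈ s.1, |x v|) ≤
      (μ + r) * ∑ v, x v ^ k := by
  have h1 := sum_sum_branchWeight_mul_le hE (y := fun v => |x v| ^ k) fun v => by positivity
  have h2 : -∑ s : E, ∏ v ∈ s.1, |x v| ≤ edgePoly E x := by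
    rw [Finset.sum_coe_sort E fun s => ∏ v ∈ s, |x v|, edgePoly, ← Finset.sum_neg_distrib]
    refine Finset.sum_le_sum fun s _ => ?_
    rw [← Finset.abs_prod]
    exact neg_abs_le _
  simp only [hk.pow_abs] at h1 ⊢
  rw [Finset.sum_sub_distrib, ← Finset.mul_sum, ← Finset.mul_sum, add_mul, ← hx]
  have h3 := mul_le_mul_of_nonneg_left h1 hr
  have h4 := mul_le_mul_of_nonneg_left h2 (Nat.cast_nonneg (α := ℝ) k)
  linarith

lemma neg_le_of_rayleigh_eq [Fintype V] (hE : (incidenceGraph E).IsTree) {k : ℕ} (hk : Even k)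
    (hk0 : k ≠ 0) (hu : ∀ s ∈ E, #s = k) {r μ : ℝ} (hr : 0 ≤ r) (hrk : r ^ k = #E) {x : V → ℝ}
    (hx0 : x ≠ 0) (hx : k * edgePoly E x = μ * ∑ v, x v ^ k) : -r ≤ μ := by
  have h := sum_gap_le hE hk hr hx
  have h0 := (Finset.sum_nonneg fun (s : E) _ => sub_nonneg.2
    (card_mul_prod_abs_le hE hk0 hr hrk s (hu _ s.2) x)).trans h
  linarith [nonneg_of_mul_nonneg_left h0 (sum_pow_pos_of_ne_zero hk hx0)]

/-- Propagation along a connected family: a property of one point that passes to all points of a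
common member of the family holds everywhere. -/
lemma forall_of_incidenceGraph_connected (hE : (incidenceGraph E).Connected) {q : V → Prop}
    (hq : ∀ s ∈ E, ∀ v ∈ s, ∀ w ∈ s, q v → q w) {v₀ : V} (h₀ : q v₀) (w : V) : q w := by
  let Q : V ⊕ E → Prop := Sum.elim q fun s => ∀ v ∈ s.1, q v
  have key : ∀ {a b} (_ : (incidenceGraph E).Walk a b), Q a → Q b := by
    intro a b p
    induction p with
    | nil => exact id
    | @cons a b c hab _ ih =>
      refine fun ha => ih ?_
      rcases a with v | s <;> rcases b with w | t
      · exact hab.elim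
      · exact fun w hw => hq t.1 t.2 v hab w hw ha
      · exact ha w hab
      · exact hab.elim
  exact key (hE (.inl v₀) (.inl w)).some h₀

/-- If the bound `-r` is attained, no member of `E` has two points that lie in further members. -/
lemma eq_of_mem_of_rayleigh_eq_neg [Fintype V] (hE : (incidenceGraph E).IsTree) {k : ℕ}
    (hk : Even k) (hk0 : k ≠ 0) (hu : ∀ s ∈ E, #s = k) {r : ℝ} (hr : 0 ≤ r) (hrk : r ^ k = #E)
    {x : V → ℝ} (hx0 : x ≠ 0) (hx : k * edgePoly E x = -r * ∑ v, x v ^ k) {s t u : E} {v w : V}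
    (hvs : v ∈ s.1) (hws : w ∈ s.1) (hst : s ≠ t) (hvt : v ∈ t.1) (hsu : s ≠ u)
    (hwu : w ∈ u.1) : v = w := by
  by_contra hvw
  have hle := fun s : E => card_mul_prod_abs_le hE hk0 hr hrk s (hu _ s.2) x
  have hgap := sum_gap_le hE hk hr hx
  rw [neg_add_cancel, zero_mul] at hgap
  have heq : ∀ s : E, r * ∑ v ∈ s.1, branchWeight E v s * |x v| ^ k - k * ∏ v ∈ s.1, |x v| = 0 :=
    fun s => (Finset.sum_eq_zero_iff_of_nonneg fun s _ => sub_nonneg.2 (hle s)).1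
      (le_antisymm hgap (Finset.sum_nonneg fun s _ => sub_nonneg.2 (hle s))) s (mem_univ s)
  have hr0 : r ≠ 0 := by
    rintro rfl
    rw [zero_pow hk0] at hrk
    exact (Finset.card_pos.2 ⟨s.1, s.2⟩).ne (by exact_mod_cast hrk)
  -- A zero coordinate makes the product vanish, hence all coordinates on that member of `E`.
  have hprop : ∀ s ∈ E, ∀ v ∈ s, ∀ w ∈ s, x v = 0 → x w = 0 := by
    intro s hs v hv w hw hxv
    have h := heq ⟨s, hs⟩
    rw [Finset.prod_eq_zero hv (by rw [hxv, abs_zero]), mul_zero, sub_zero] at h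
    have h := (Finset.sum_eq_zero_iff_of_nonneg fun v _ =>
      mul_nonneg (branchWeight_pos hE v ⟨s, hs⟩).le (by positivity)).1
      ((mul_eq_zero.1 h).resolve_left hr0) w hw
    exact abs_eq_zero.1 (eq_zero_of_pow_eq_zero
      ((mul_eq_zero.1 h).resolve_left (branchWeight_pos hE w ⟨s, hs⟩).ne'))
  have hne : ∀ v, x v ≠ 0 := fun v hv =>
    hx0 (funext fun w => forall_of_incidenceGraph_connected hE.connected hprop hv w)
  have hlt := card_mul_prod_abs_lt hE hr hrk s (hu _ s.2) (fun v _ => hne v) hk0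
    (inv_card_lt_prod_branchWeight hE hvw hvs hws hst hvt hsu hwu)
  linarith [heq s]

end SpectralBound

/-! ### Stars -/

/-- The family `E` is a star with centre `c`: all members contain `c`, they are otherwise disjoint,
and they cover all other points. -/
structure IsStarAt {V : Type*} (E : Finset (Finset V)) (c : V) : Prop where
  center_mem : ∀ s ∈ E, c ∈ s
  eq_center : ∀ s ∈ E, ∀ t ∈ E, s ≠ t → ∀ v ∈ s, v ∈ t → v = c
  eq_center_or_mem : ∀ v, v = c ∨ ∃ s ∈ E, v ∈ s

lemma exists_isStarAt {V : Type*} {E : Finset (Finset V)} [Nonempty V]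
    (hE : (incidenceGraph E).Connected) (hne : ∀ s ∈ E, s.Nonempty)
    (h : ∀ {s t u : E} {v w : V}, v ∈ s.1 → w ∈ s.1 → s ≠ t → v ∈ t.1 → s ≠ u → w ∈ u.1 → v = w) :
    ∃ c, IsStarAt E c := by
  -- The centre is a point of degree at least two, or any point if there is none.
  obtain ⟨c, hc⟩ : ∃ c, ∀ s t : E, s ≠ t → c ∈ s.1 → ∀ w ∈ s.1, w ∈ t.1 → w = c := by
    by_cases hd : ∃ (c : V) (s t : E), s ≠ t ∧ c ∈ s.1 ∧ c ∈ t.1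
    · obtain ⟨c, s₀, t₀, hst₀, hcs₀, hct₀⟩ := hd
      refine ⟨c, fun s t hst hcs w hws hwt => ?_⟩
      by_cases hs : s = s₀
      · subst hs
        exact h hws hcs hst hwt hst₀ hct₀
      · exact h hws hcs hst hwt hs hcs₀
    · obtain ⟨c⟩ := ‹Nonempty V›
      exact ⟨c, fun s t hst _ w hws hwt => (hd ⟨w, s, t, hst, hws, hwt⟩).elim⟩
  have hcover : ∀ v, v = c ∨ ∃ s ∈ E, v ∈ s ∧ c ∈ s := by
    refine forall_of_incidenceGraph_connected hE (v₀ := c) ?_ (Or.inl rfl)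
    rintro t ht v hvt w hwt (rfl | ⟨s, hs, hvs, hcs⟩)
    · exact Or.inr ⟨t, ht, hwt, hvt⟩
    · by_cases hst : s = t
      · exact Or.inr ⟨t, ht, hwt, hst ▸ hcs⟩
      · have := hc ⟨s, hs⟩ ⟨t, ht⟩ (by simpa using hst) hcs v hvs hvt
        exact Or.inr ⟨t, ht, hwt, this ▸ hvt⟩
  have hmem : ∀ s ∈ E, c ∈ s := by
    intro t ht
    obtain ⟨v, hvt⟩ := hne t ht
    rcases hcover v with rfl | ⟨s, hs, hvs, hcs⟩
    · exact hvt
    · by_cases hst : s = t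
      · exact hst ▸ hcs
      · have := hc ⟨s, hs⟩ ⟨t, ht⟩ (by simpa using hst) hcs v hvs hvt
        exact this ▸ hvt
  refine ⟨c, hmem, fun s hs t ht hst v hvs hvt => ?_, fun v => ?_⟩
  · exact hc ⟨s, hs⟩ ⟨t, ht⟩ (by simpa using hst) (hmem s hs) v hvs hvt
  · exact (hcover v).imp_right fun ⟨s, hs, hv, _⟩ => ⟨s, hs, hv⟩

/-! ### Uniqueness of uniform stars -/

namespace IsStarAt

variable {V : Type*} {E : Finset (Finset V)} {c : V}

lemma filter_mem_eq_singleton [DecidableEq V] (h : IsStarAt E c) {v : V} (hv : v ≠ c) :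
    ∃ s ∈ E, {t ∈ E | v ∈ t} = {s} := by
  obtain ⟨s, hs, hvs⟩ := (h.eq_center_or_mem v).resolve_left hv
  refine ⟨s, hs, Finset.ext fun t => ?_⟩
  rw [mem_filter, mem_singleton]
  refine ⟨fun ht => ?_, fun ht => ht ▸ ⟨hs, hvs⟩⟩
  by_contra hne
  exact hv (h.eq_center t ht.1 s hs hne v ht.2 hvs)

/-- A uniform star is determined up to relabelling by the number `m` and the size `k` of its
members: the points are the centre and `k - 1` further points for each member. -/
lemma exists_equiv [DecidableEq V] (h : IsStarAt E c) {k m : ℕ} (hu : ∀ s ∈ E, #s = k)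
    (hm : #E = m) :
    ∃ g : Option (Fin m × Fin (k - 1)) ≃ V, ∀ s : Finset V,
      s ∈ E ↔ ∃ i, s = (insert none (univ.image fun j => some (i, j))).map g.toEmbedding := by
  let σ : E ≃ Fin m := E.equivFinOfCardEq hm
  let τ : ∀ s : E, s.1.erase c ≃ Fin (k - 1) := fun s =>
    Finset.equivFinOfCardEq (by rw [card_erase_of_mem (h.center_mem _ s.2), hu _ s.2])
  let g : Option (Fin m × Fin (k - 1)) → V := fun o =>
    o.elim c fun p => ((τ (σ.symm p.1)).symm p.2).1
  have hgmem : ∀ i j, g (some (i, j)) ∈ (σ.symm i).1.erase c := fun i j =>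
    ((τ (σ.symm i)).symm j).2
  have hinj : Function.Injective g := by
    rintro (_ | ⟨i, j⟩) (_ | ⟨i', j'⟩) heq
    · rfl
    · exact absurd heq.symm (ne_of_mem_erase (hgmem i' j'))
    · exact absurd heq (ne_of_mem_erase (hgmem i j))
    · have hi : i = i' := by
        by_contra hne
        refine ne_of_mem_erase (hgmem i j) (h.eq_center _ (σ.symm i).2 _ (σ.symm i').2 ?_ _
          (mem_of_mem_erase (hgmem i j)) (heq ▸ mem_of_mem_erase (hgmem i' j')))
        exact fun hs => hne (σ.symm.injective (Subtype.ext hs))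
      subst hi
      have hj : j = j' := (τ (σ.symm i)).symm.injective (Subtype.ext heq)
      rw [hj]
  have hτ : ∀ (s : E) (v : V) (hv : v ∈ s.1.erase c), g (some (σ s, τ s ⟨v, hv⟩)) = v := by
    intro s v hv
    simp only [g, Option.elim_some]
    have : ∀ (t : E) (ht : t = s), ((τ t).symm (τ s ⟨v, hv⟩)).1 = v := by
      rintro t rfl
      simp
    exact this _ (σ.symm_apply_apply s)
  have hsurj : Function.Surjective g := by
    intro v
    by_cases hv : v = c
    · exact ⟨none, hv.symm⟩
    · obtain ⟨s, hs, hvs⟩ := (h.eq_center_or_mem v).resolve_left hv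
      exact ⟨_, hτ ⟨s, hs⟩ v (mem_erase.2 ⟨hv, hvs⟩)⟩
  have hblock : ∀ i, (insert none (univ.image fun j => some (i, j))).map
      (Equiv.ofBijective g ⟨hinj, hsurj⟩).toEmbedding = (σ.symm i).1 := by
    intro i
    ext v
    simp only [mem_map, mem_insert, mem_image, mem_univ, true_and, Equiv.coe_toEmbedding]
    constructor
    · rintro ⟨_, (rfl | ⟨j, rfl⟩), rfl⟩
      · exact h.center_mem _ (σ.symm i).2
      · exact mem_of_mem_erase (hgmem i j)
    · intro hv
      by_cases hvc : v = c
      · exact ⟨none, Or.inl rfl, hvc.symm⟩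
      · have := hτ (σ.symm i) v (mem_erase.2 ⟨hvc, hv⟩)
        rw [σ.apply_symm_apply] at this
        exact ⟨_, Or.inr ⟨_, rfl⟩, this⟩
  refine ⟨Equiv.ofBijective g ⟨hinj, hsurj⟩, fun s => ⟨fun hs => ⟨σ ⟨s, hs⟩, ?_⟩, ?_⟩⟩
  · rw [hblock, σ.symm_apply_apply]
  · rintro ⟨i, rfl⟩
    rw [hblock]
    exact (σ.symm i).2

end IsStarAt

/-! ### Stars and isomorphisms of hypergraphs -/

namespace Hypergraph

variable {α β : Type*}

/-- `T` is a `k`-uniform star with `m` edges. -/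
def IsUniformStar (T : Hypergraph α) [Fintype T.vertexSet] (k m : ℕ) : Prop :=
  T.IsUniformOfSize k ∧ T.edgeSet.ncard = m ∧ ∃ c, IsStarAt T.finEdges c

section Transfer

variable {G : Hypergraph α} {H : Hypergraph β} [Fintype G.vertexSet] [Fintype H.vertexSet]

lemma isomorphic_iff_finEdges :
    G.Isomorphic H ↔ ∃ f : G.vertexSet ≃ H.vertexSet, ∀ s : Finset G.vertexSet,
      s ∈ G.finEdges ↔ s.map f.toEmbedding ∈ H.finEdges := by
  refine exists_congr fun f => ⟨fun h s => ?_, fun h e => ?_⟩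
  · rw [mem_finEdges, mem_finEdges, h, coe_map]
    rfl
  · obtain ⟨s, rfl⟩ : ∃ s : Finset G.vertexSet, (s : Set G.vertexSet) = e :=
      ⟨e.toFinite.toFinset, by simp⟩
    have := h s
    rwa [mem_finEdges, mem_finEdges, coe_map] at this

lemma isUniformOfSize_iff {k : ℕ} : G.IsUniformOfSize k ↔ ∀ s ∈ G.finEdges, #s = k := by
  refine ⟨fun h s hs => card_of_mem_finEdges h hs, fun h e he => ?_⟩
  obtain ⟨s, hs, rfl⟩ := exists_mem_finEdges he
  rw [Set.ncard_image_of_injective _ Subtype.val_injective, Set.ncard_coe_finset, h s hs]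

lemma IsUniformStar.of_isomorphic {k m : ℕ} (hH : H.IsUniformStar k m) (h : G.Isomorphic H) :
    G.IsUniformStar k m := by
  obtain ⟨f, hf⟩ := isomorphic_iff_finEdges.1 h
  obtain ⟨hu, hm, c, hc⟩ := hH
  have hf' : ∀ t ∈ H.finEdges, t.map f.symm.toEmbedding ∈ G.finEdges := by
    intro t ht
    rw [hf, map_map]
    convert ht
    ext
    simp
  refine ⟨isUniformOfSize_iff.2 fun s hs => ?_, ?_, f.symm c, fun s hs => ?_, ?_, fun v => ?_⟩
  · rw [← card_map f.toEmbedding, isUniformOfSize_iff.1 hu _ ((hf s).1 hs)]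
  · rw [← hm, ← card_finEdges, ← card_finEdges]
    refine Finset.card_bij (fun s _ => s.map f.toEmbedding) (fun s hs => (hf s).1 hs)
      (fun s _ t _ h => Finset.map_injective _ h) fun t ht => ⟨_, hf' t ht, ?_⟩
    ext
    simp
  · have := hc.center_mem _ ((hf s).1 hs)
    rwa [mem_map_equiv] at this
  · intro s hs t ht hst v hvs hvt
    rw [f.eq_symm_apply]
    exact hc.eq_center _ ((hf s).1 hs) _ ((hf t).1 ht) (fun h => hst (Finset.map_injective _ h)) _
      (mem_map_of_mem _ hvs) (mem_map_of_mem _ hvt)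
  · rw [f.eq_symm_apply]
    refine (hc.eq_center_or_mem (f v)).imp_right fun ⟨t, ht, hv⟩ => ⟨_, hf' t ht, ?_⟩
    rwa [mem_map_equiv, Equiv.symm_symm]

lemma IsUniformStar.isomorphic {k m : ℕ} (hG : G.IsUniformStar k m) (hH : H.IsUniformStar k m) :
    G.Isomorphic H := by
  classical
  obtain ⟨hGu, hGm, c, hc⟩ := hG
  obtain ⟨hHu, hHm, d, hd⟩ := hH
  obtain ⟨g, hg⟩ := hc.exists_equiv (isUniformOfSize_iff.1 hGu) (card_finEdges.trans hGm)
  obtain ⟨h, hh⟩ := hd.exists_equiv (isUniformOfSize_iff.1 hHu) (card_finEdges.trans hHm)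
  refine isomorphic_iff_finEdges.2 ⟨g.symm.trans h, fun s => ?_⟩
  rw [hg, hh]
  refine exists_congr fun i => ?_
  rw [← (Finset.map_injective (g.symm.trans h).toEmbedding).eq_iff, map_map]
  convert Iff.rfl using 3
  ext
  simp

end Transfer

lemma isomorphic_image (G : Hypergraph α) {f : α → β} (hf : Function.Injective f) :
    (G.image f).Isomorphic G := by
  let F : G.vertexSet ≃ (G.image f).vertexSet := Equiv.Set.image f G.vertexSet hf
  refine ⟨F.symm, fun e => ?_⟩
  have hF : ∀ v, f (F.symm v).1 = v.1 := fun v => by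
    obtain ⟨w, rfl⟩ := F.surjective v
    rw [F.symm_apply_apply]
    rfl
  have : Subtype.val '' e = f '' (Subtype.val '' (F.symm '' e)) := by
    rw [Set.image_image, Set.image_image]
    exact Set.image_congr fun v _ => (hF v).symm
  rw [this]
  refine ⟨?_, fun h => ⟨_, h, rfl⟩⟩
  rintro ⟨e', he', h⟩
  rwa [← hf.image_injective h]

variable {T : Hypergraph α}

/-! ### The least eigenvalue of stars and of hypertrees -/

section Star

variable [Fintype T.vertexSet]

/-- The star condition on the finite sets of vertices, in terms of the edge set of `T`. -/
lemma isStarAt_finEdges_iff {c : T.vertexSet} :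
    IsStarAt T.finEdges c ↔ (∀ e ∈ T.edgeSet, c.1 ∈ e) ∧
      (∀ e ∈ T.edgeSet, ∀ f ∈ T.edgeSet, e ≠ f → ∀ v ∈ e, v ∈ f → v = c.1) ∧
      ∀ v ∈ T.vertexSet, v = c.1 ∨ ∃ e ∈ T.edgeSet, v ∈ e := by
  constructor
  · rintro ⟨h1, h2, h3⟩
    refine ⟨fun e he => ?_, fun e he f hf hef v hve hvf => ?_, fun v hv => ?_⟩
    · obtain ⟨s, hs, rfl⟩ := exists_mem_finEdges he
      exact Set.mem_image_of_mem _ (h1 s hs)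
    · obtain ⟨s, hs, rfl⟩ := exists_mem_finEdges he
      obtain ⟨t, ht, rfl⟩ := exists_mem_finEdges hf
      obtain ⟨v, hvs, rfl⟩ := hve
      obtain ⟨w, hwt, hwv⟩ := hvf
      obtain rfl := Subtype.val_injective hwv
      exact congrArg Subtype.val (h2 s hs t ht (by rintro rfl; exact hef rfl) w hvs hwt)
    · refine (h3 ⟨v, hv⟩).imp (congrArg Subtype.val) fun ⟨s, hs, hvs⟩ =>
        ⟨_, mem_finEdges.1 hs, _, hvs, rfl⟩
  · rintro ⟨h1, h2, h3⟩
    have hmem : ∀ {s : Finset T.vertexSet} {v : T.vertexSet},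
        v.1 ∈ Subtype.val '' (s : Set T.vertexSet) → v ∈ s := fun h => by simpa using h
    refine ⟨fun s hs => hmem (h1 _ (mem_finEdges.1 hs)), fun s hs t ht hst v hvs hvt => ?_,
      fun v => ?_⟩
    · refine Subtype.val_injective (h2 _ (mem_finEdges.1 hs) _ (mem_finEdges.1 ht) (fun h => hst
        (Finset.coe_injective (Subtype.val_injective.image_injective h))) _
        (Set.mem_image_of_mem _ hvs) (Set.mem_image_of_mem _ hvt))
    · refine (h3 v.1 v.2).imp (fun h => Subtype.val_injective h) ?_
      rintro ⟨e, he, hv⟩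
      obtain ⟨s, hs, rfl⟩ := exists_mem_finEdges he
      exact ⟨s, hs, hmem hv⟩

lemma IsUniformStar.isUniformHypertree {k m : ℕ} (hT : T.IsUniformStar k m) :
    T.IsUniformHypertree k m := by
  obtain ⟨hu, hm, c, hc⟩ := hT
  obtain ⟨h1, h2, h3⟩ := isStarAt_finEdges_iff.1 hc
  refine ⟨hu, ⟨⟨⟨c.1, c.2⟩, fun u hu v hv => ?_⟩, ?_⟩, hm⟩
  · have key : ∀ v ∈ T.vertexSet, v = c.1 ∨ T.Adj v c.1 := fun v hv =>
      (h3 v hv).imp_right fun ⟨e, he, hve⟩ => ⟨e, he, hve, h1 e he⟩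
    refine Relation.ReflTransGen.trans (b := c.1) ?_ ?_
    · rcases key u hu with rfl | h
      · exact .refl
      · exact .single h
    · rcases key v hv with rfl | h
      · exact .refl
      · exact .single h.symm
  · -- Consecutive edges of a cycle meet in the centre only, so two vertices would coincide.
    rintro ⟨n, v, e, hv, he, h⟩
    have key : ∀ i, v (i + 1) = c.1 := fun i =>
      h2 _ (h i).1 _ (h (i + 1)).1 (fun h' => by simpa using he h') _ (h i).2.2 (h (i + 1)).2.1
    have := hv ((key 0).trans (key 1).symm)
    simp at this

lemma IsUniformStar.leastEigenvalue_le {k m : ℕ} [NeZero k] (hk : Even k)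
    (hT : T.IsUniformStar k m) {r : ℝ} (hrk : r ^ k = m) :
    T.leastEigenvalue k ≤ -r := by
  classical
  obtain ⟨hu, hm, c, hc⟩ := hT
  have hk0 := NeZero.ne k
  refine (isLeast_leastEigenvalue hk hu ⟨c.1, c.2⟩).1.2 ?_
  rw [← card_finEdges] at hm
  rcases Nat.eq_zero_or_pos m with rfl | hmpos
  · have hr : r = 0 := eq_zero_of_pow_eq_zero (n := k) (by simpa using hrk)
    refine ⟨fun _ => 1, fun h => one_ne_zero (congrFun h c), fun i => ?_⟩
    rw [adjacencyTensor_apply hu, Finset.card_eq_zero.1 hm, hr]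
    simp
  -- The eigenvector is `-r` at the centre and `1` elsewhere.
  have hr : r ≠ 0 := by
    rintro rfl
    rw [zero_pow hk0] at hrk
    exact hmpos.ne (by exact_mod_cast hrk)
  refine ⟨fun v => if v = c then -r else 1, fun h => hr ?_, fun i => ?_⟩
  · simpa using congrFun h c
  rw [adjacencyTensor_apply hu]
  beta_reduce
  by_cases hi : i = c
  · subst hi
    have h1 : ∀ s ∈ T.finEdges.filter (i ∈ ·),
        ∏ v ∈ s.erase i, (if v = i then -r else 1) = 1 := fun s _ =>
      Finset.prod_eq_one fun v hv => if_neg (ne_of_mem_erase hv)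
    rw [Finset.sum_congr rfl h1, Finset.filter_true_of_mem hc.center_mem, if_pos rfl,
      mul_pow_sub_one hk0, hk.neg_pow, hrk]
    simp [hm]
  · obtain ⟨s, hs, hfil⟩ := hc.filter_mem_eq_singleton hi
    rw [hfil, Finset.sum_singleton, if_neg hi, Finset.prod_ite_eq' (s.erase i) c fun _ => -r,
      if_pos (mem_erase.2 ⟨Ne.symm hi, hc.center_mem s hs⟩)]
    simp

lemma neg_le_leastEigenvalue {k m : ℕ} [NeZero k] (hk : Even k) (hT : T.IsUniformHypertree k m)
    {r : ℝ} (hr : 0 ≤ r) (hrk : r ^ k = m) : -r ≤ T.leastEigenvalue k := by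
  obtain ⟨hu, ht, hm⟩ := hT
  obtain ⟨x, hx0, hx⟩ := (isLeast_leastEigenvalue hk hu ht.1.1).2
  exact neg_le_of_rayleigh_eq (isTree_incidenceGraph (NeZero.ne k) hu ht) hk (NeZero.ne k)
    (isUniformOfSize_iff.1 hu) hr (by rw [hrk, card_finEdges, hm]) hx0 hx

lemma isUniformStar_of_leastEigenvalue_eq {k m : ℕ} [NeZero k] (hk : Even k)
    (hT : T.IsUniformHypertree k m) {r : ℝ} (hr : 0 ≤ r) (hrk : r ^ k = m)
    (h : T.leastEigenvalue k = -r) : T.IsUniformStar k m := by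
  obtain ⟨hu, ht, hm⟩ := hT
  obtain ⟨x, hx0, hx⟩ := (isLeast_leastEigenvalue hk hu ht.1.1).2
  have htree := isTree_incidenceGraph (NeZero.ne k) hu ht
  have hcard := isUniformOfSize_iff.1 hu
  rw [h] at hx
  have := ht.1.1.to_subtype
  refine ⟨hu, hm, exists_isStarAt htree.connected (fun s hs => ?_)
    (eq_of_mem_of_rayleigh_eq_neg htree hk (NeZero.ne k) hcard hr
      (by rw [hrk, card_finEdges, hm]) hx0 hx)⟩
  rw [← Finset.card_pos, hcard s hs]
  exact NeZero.pos k

end Star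

/-! ### The hyperstar -/

noncomputable instance (m k : ℕ) : Fintype (hyperstar m k).vertexSet :=
  Fintype.ofFinite _

lemma zero_mem_of_mem_edgeSet_starGraph {m : ℕ} {e : Sym2 (Fin (m + 1))}
    (he : e ∈ (SimpleGraph.starGraph (0 : Fin (m + 1))).edgeSet) : 0 ∈ e := by
  induction e with
  | _ a b =>
    rw [SimpleGraph.mem_edgeSet, SimpleGraph.starGraph_adj] at he
    rcases he.2 with rfl | rfl
    · exact Sym2.mem_mk_left _ _
    · exact Sym2.mem_mk_right _ _

lemma isUniformStar_hyperstar {k : ℕ} (hk : 2 ≤ k) (m : ℕ) :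
    (hyperstar m k).IsUniformStar k m := by
  refine ⟨?_, ?_, ⟨.inl 0, Set.mem_univ _⟩, isStarAt_finEdges_iff.2 ⟨?_, ?_, ?_⟩⟩
  · rintro _ ⟨e, rfl⟩
    dsimp only
    rw [Set.ncard_union_eq, Set.ncard_image_of_injective _ Sum.inl_injective,
      Set.ncard_image_of_injective _ Sum.inr_injective]
    · have h1 : {v | v ∈ (e : Sym2 (Fin (m + 1)))}.ncard = 2 := by
        obtain ⟨e, he⟩ := e
        induction e with
        | _ a b =>
          rw [SimpleGraph.mem_edgeSet] at he
          rw [← Set.ncard_pair he.ne]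
          congr 1
          ext v
          simp
      have h2 : {p : (SimpleGraph.starGraph (0 : Fin (m + 1))).edgeSet × Fin (k - 2) |
          p.1 = e}.ncard = k - 2 := by
        have : {p : (SimpleGraph.starGraph (0 : Fin (m + 1))).edgeSet × Fin (k - 2) |
            p.1 = e} = {e} ×ˢ Set.univ := by
          ext p
          simp
        rw [this, Set.ncard_prod]
        simp [Set.ncard_univ]
      rw [h1, h2]
      omega
    · rw [Set.disjoint_left]
      rintro _ ⟨v, _, rfl⟩ ⟨p, _, hp⟩
      cases hp
  · have hinj : Function.Injective fun e : (SimpleGraph.starGraph (0 : Fin (m + 1))).edgeSet =>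
        (Sum.inl '' {v | v ∈ (e : Sym2 (Fin (m + 1)))} ∪ Sum.inr '' {p | p.1 = e} :
          Set (Fin (m + 1) ⊕
            (SimpleGraph.starGraph (0 : Fin (m + 1))).edgeSet × Fin (k - 2))) := by
      intro e f h
      refine Subtype.ext (Sym2.ext fun v => ?_)
      simpa using Set.ext_iff.1 h (.inl v)
    have hcard := (SimpleGraph.isTree_starGraph (0 : Fin (m + 1))).card_edgeFinset
    rw [Fintype.card_fin] at hcard
    change (Set.range _).ncard = m
    rw [← Set.image_univ, Set.ncard_image_of_injective _ hinj, Set.ncard_univ,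
      Nat.card_eq_fintype_card, ← SimpleGraph.edgeFinset_card]
    omega
  · rintro _ ⟨e, rfl⟩
    exact Or.inl ⟨0, zero_mem_of_mem_edgeSet_starGraph e.2, rfl⟩
  · rintro _ ⟨e, rfl⟩ _ ⟨f, rfl⟩ hef (a | p) hve hvf
    · simp only [Set.mem_union, Set.mem_image, Set.mem_ofPred_eq, Sum.inl.injEq,
        exists_eq_right, reduceCtorEq, and_false, exists_false, or_false] at hve hvf
      by_contra ha
      have ha : (0 : Fin (m + 1)) ≠ a := fun h => ha (by rw [← h])
      refine hef ?_
      have : e = f := Subtype.ext (by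
        rw [(Sym2.mem_and_mem_iff ha).1 ⟨zero_mem_of_mem_edgeSet_starGraph e.2, hve⟩,
          (Sym2.mem_and_mem_iff ha).1 ⟨zero_mem_of_mem_edgeSet_starGraph f.2, hvf⟩])
      rw [this]
    · simp only [Set.mem_union, Set.mem_image, Set.mem_ofPred_eq, Sum.inr.injEq,
        exists_eq_right, reduceCtorEq, and_false, exists_false, false_or] at hve hvf
      exact absurd (by rw [← hve, ← hvf]) hef
  · rintro (a | p) -
    · by_cases ha : a = 0
      · exact Or.inl (by rw [ha])
      · refine Or.inr ⟨_, ⟨⟨s(0, a), ?_⟩, rfl⟩, Or.inl ⟨a, Sym2.mem_mk_right _ _, rfl⟩⟩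
        exact SimpleGraph.starGraph_center_adj (Ne.symm ha)
    · exact Or.inr ⟨_, ⟨p.1, rfl⟩, Or.inr ⟨p, rfl, rfl⟩⟩

end Hypergraph

/-! ### The extremal hypertree -/

theorem corollary4p3 (k m : ℕ) [NeZero k] (hk : Even k) :
    (∀ (α : Type u) (T : Hypergraph α) [Fintype T.vertexSet], T.IsUniformHypertree k m →
      IsLeast {μ : ℝ | (T.adjacencyTensor k).IsHEigenvalue μ} (T.leastEigenvalue k)) ∧
    (Hypergraph.hyperstar m k).IsUniformHypertree k m ∧
    (∀ (α : Type u) (T : Hypergraph α) [Fintype T.vertexSet],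
      Hypergraph.IsMinimizingHypertree.{u, v} T k m ↔
        T.Isomorphic (Hypergraph.hyperstar m k)) := by
  have hk0 := NeZero.ne k
  have hk2 : 2 ≤ k := by
    obtain ⟨l, hl⟩ := hk
    omega
  have hstar := Hypergraph.isUniformStar_hyperstar hk2 m
  obtain ⟨r, hr, hrk⟩ : ∃ r : ℝ, 0 ≤ r ∧ r ^ k = m :=
    ⟨(m : ℝ) ^ (k : ℝ)⁻¹, by positivity, Real.rpow_inv_natCast_pow (by positivity) hk0⟩
  refine ⟨fun α T _ hT => (Hypergraph.isLeast_leastEigenvalue hk hT.1 hT.2.1.1.1).1,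
    hstar.isUniformHypertree, fun α T _ => ⟨fun hT => ?_, fun hT => ?_⟩⟩
  · -- Compare with a copy of the hyperstar in the universe of the competitors.
    let S := (Hypergraph.hyperstar m k).image ULift.up.{v}
    let _ : Fintype S.vertexSet := Fintype.ofFinite _
    have hS : S.IsUniformStar k m :=
      hstar.of_isomorphic (Hypergraph.isomorphic_image _ ULift.up_injective)
    have hle := (hT.2 _ S hS.isUniformHypertree).trans (hS.leastEigenvalue_le hk hrk)
    exact (Hypergraph.isUniformStar_of_leastEigenvalue_eq hk hT.1 hr hrk
      (hle.antisymm (Hypergraph.neg_le_leastEigenvalue hk hT.1 hr hrk))).isomorphic hstar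
  · have hTs := hstar.of_isomorphic hT
    exact ⟨hTs.isUniformHypertree, fun β T' _ hT' => (hTs.leastEigenvalue_le hk hrk).trans
      (Hypergraph.neg_le_leastEigenvalue hk hT' hr hrk)⟩
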